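/- Let $\mathbf F\in\{\mathbf R,\mathbf C\}$ and let $d,n\ge 1$ be integers. Write $u\cdot v=\sum_k u_k\overline{v_k}$ on $\mathbf F^n$, let $L^0(\mathbf R^d;\mathbf F^n)$ be the space of measurable functions modulo a.e. equality, and let $L^\infty_c(\mathbf R^d;\mathbf F^n)$ be the space of bounded functions with compact support. Cubes have sides parallel to the coordinate axes. *Convex bodies.* Let $\mathcal K$ be the class of non-empty, closed, convex $K\subseteq\mathbf F^n$ with $\lambda K\subseteq K$ for all $|\lambda|=1$, and let $\mathcal K(B)$ be the smallest member of $\mathcal K$ containing $B\subseteq \mathbf F^n$; write $\mathcal K(u)=\mathcal K(\{u\})$. Let $L^0(\mathbf R^d;\mathcal K)$ be the set of maps $F:\mathbf R^d\to\mathcal K$ for which $\{x:F(x)\cap U\ne\emptyset\}$ is Lebesgue measurable for every open $U\subseteq\mathbf F^n$, and let $S^0(F)=\{f\in L^0(\mathbf R^d;\mathbf F^n): f(x)\in F(x)\text{ a.e.}\}$. For a cube $Q$ put $\langle F\rangle_Q=\{|Q|^{-1}\int_Q f\,dx: f\in S^0(F)\}$; it is considered for $F\in L^1_{\rm loc}(\mathbf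 R^d;\mathcal K)$, i.e. when $S^0(F\mathbf 1_Q)$ is bounded in $L^1$ for every cube $Q$. For such $F$ let $M^{\mathcal K}F(x)=\mathcal K\big(\bigcup_{Q\ni x}\langle F\rangle_Q\big)$, the union being over all cubes $Q$ containing $x$. For $f\in L^\infty_c(\mathbf R^d;\mathbf F^n)$ put $\langle\!\langle f\rangle\!\rangle_Q=\{|Q|^{-1}\int_Q hf\,dx:\|h\|_{L^\infty(\mathbf R^d)}\le 1\}$ with $h$ scalar valued. A sum $\sum_{Q\in\mathcal S}\langle\!\langle f\rangle\!\rangle_Q\mathbf 1_Q(x)$ is the closure of the union of its finite partial Minkowski sums. *Sparseness.* A collection $\mathcal S$ of cubes is sparse if there are pairwise disjoint measurable sets $E_Q\subseteq Q$ ($Q\in\mathcal S$) with $|E_Q|\ge\frac12|Q|$. *Spaces.* An $\mathbf F^n$-directional Banach function space is a complete normed subspace $\mathbf X$ of $L^0(\mathbf R^d;\mathbf F^n)$ such that (i) if $f\in\mathbf X$, $g\in L^0(\mathbf R^d;\mathbf F^n)$ and $\mathcal K(g(x))\subseteq\mathcal K(f(x))$ for a.e. $x$, then $g\in\mathbf X$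 and $\|g\|_{\mathbf X}\le\|f\|_{\mathbf X}$; (ii) if $g\in L^0(\mathbf R^d;\mathbf F^n)$ and, for all $f\in\mathbf X$, $f\cdot g$ is integrable with $\int f\cdot g\,dx=0$, then $g=0$. Let $\|g\|_{\mathbf X'}=\sup_{\|f\|_{\mathbf X}=1}\int|f\cdot g|\,dx$ and let $\mathbf X'$ be the space of $g$ with $\|g\|_{\mathbf X'}<\infty$; $\mathbf X$ is Köthe reflexive if $\mathbf X''=\mathbf X$ with equal norm. For $\mathbf Y\in\{\mathbf X,\mathbf X'\}$ let $\mathbf Y[\mathcal K]$ be the set of $F\in L^0(\mathbf R^d;\mathcal K)$ with $S^0(F)$ a bounded subset of $\mathbf Y$, $\|F\|_{\mathbf Y[\mathcal K]}=\sup_{f\in S^0(F)}\|f\|_{\mathbf Y}$. We write $M^{\mathcal K}:\mathbf Y[\mathcal K]\to\mathbf Y[\mathcal K]$ if $\mathbf Y[\mathcal K]\subseteq L^1_{\rm loc}(\mathbf R^d;\mathcal K)$, $M^{\mathcal K}$ maps $\mathbf Y[\mathcal K]$ into itself, and $\|M^{\mathcal K}F\|_{\mathbf Y[\mathcal K]}\le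 C\|F\|_{\mathbf Y[\mathcal K]}$ for some $C<\infty$ and all $F\in\mathbf Y[\mathcal K]$; the least such $C$ is $\|M^{\mathcal K}\|_{\mathbf Y[\mathcal K]\to\mathbf Y[\mathcal K]}$. **Statement.** For given $\mathbf F$ and $n$ there is a constant $C<\infty$ (not depending on $d$ or on any of the following data) such that the following holds. Let $T:L^\infty_c(\mathbf R^d;\mathbf F^n)\to L^0(\mathbf R^d;\mathbf F^n)$ be a (not necessarily linear) map and $C_T>0$ a constant such that for every $f\in L^\infty_c(\mathbf R^d;\mathbf F^n)$ there is a sparse collection $\mathcal S$ of cubes with $$Tf(x)\in C_T\sum_{Q\in\mathcal S}\langle\!\langle f\rangle\!\rangle_Q\mathbf 1_Q(x)\quad\text{for a.e. }x\in\mathbf R^d.$$ Let $\mathbf X$ be a Köthe reflexive $\mathbf F^n$-directional Banach function space with $M^{\mathcal K}:\mathbf X[\mathcal K]\to\mathbf X[\mathcal K]$ and $M^{\mathcal K}:\mathbf X'[\mathcal K]\to\mathbf X'[\mathcal K]$. Then for all $f\in L^\infty_c(\mathbf R^d;\mathbf F^n)\cap\mathbf X$ we have $Tf\in\mathbf X$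 and $$\|Tf\|_{\mathbf X}\le C\,C_T\,\|M^{\mathcal K}\|_{\mathbf X[\mathcal K]\to\mathbf X[\mathcal K]}\,\|M^{\mathcal K}\|_{\mathbf X'[\mathcal K]\to\mathbf X'[\mathcal K]}\,\|f\|_{\mathbf X}.$$ -/

import Mathlib

open MeasureTheory Set Filter
open scoped ENNReal NNReal Topology Pointwise

noncomputable section

/-- `L⁰(ℝᵈ; 𝕜ⁿ)`: Lebesgue measurable functions modulo almost everywhere equality. -/
abbrev LZero (𝕜 : Type*) [RCLike 𝕜] (d n : ℕ) :=
  (Fin d → ℝ) →ₘ[volume] EuclideanSpace 𝕜 (Fin n)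

/-! ### Convex bodies and convex-set valued mappings -/

/-- The class `𝒦` of non-empty, closed, convex and symmetric subsets of `𝕜ⁿ`. -/
structure IsSymConvex (𝕜 : Type*) [RCLike 𝕜] {n : ℕ}
    (K : Set (EuclideanSpace 𝕜 (Fin n))) : Prop where
  nonempty : K.Nonempty
  isClosed : IsClosed K
  convex : ∀ u ∈ K, ∀ v ∈ K, ∀ t : ℝ, 0 ≤ t → t ≤ 1 →
    ((1 - t : ℝ) : 𝕜) • u + ((t : ℝ) : 𝕜) • v ∈ K
  symmetric : ∀ u ∈ K, ∀ c : 𝕜, ‖c‖ = 1 → c • u ∈ K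

/-- `𝒦(B)`: the smallest set of the class `𝒦` that contains `B`. -/
def symHull (𝕜 : Type*) [RCLike 𝕜] {n : ℕ} (B : Set (EuclideanSpace 𝕜 (Fin n))) :
    Set (EuclideanSpace 𝕜 (Fin n)) :=
  ⋂₀ {K | IsSymConvex 𝕜 K ∧ B ⊆ K}

/-- `F ∈ L⁰(ℝᵈ; 𝒦)`: the values of `F` lie in `𝒦`, and `{x | F x ∩ U ≠ ∅}` is Lebesgue measurable
for every open `U`. (Lebesgue measure being complete and `σ`-finite, testing with Borel sets
instead of open sets gives the same class of closed-set valued mappings.) -/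
structure IsMeasurableBodyMap {𝕜 : Type*} [RCLike 𝕜] {d n : ℕ}
    (F : (Fin d → ℝ) → Set (EuclideanSpace 𝕜 (Fin n))) : Prop where
  mem : ∀ x, IsSymConvex 𝕜 (F x)
  measurable : ∀ U : Set (EuclideanSpace 𝕜 (Fin n)), IsOpen U →
    NullMeasurableSet {x | (F x ∩ U).Nonempty} (volume : Measure (Fin d → ℝ))

/-- `S⁰(ℝᵈ; F)`: the measurable selections of `F`. -/
def selections {𝕜 : Type*} [RCLike 𝕜] {d n : ℕ}
    (F : (Fin d → ℝ) → Set (EuclideanSpace 𝕜 (Fin n))) : Set (LZero 𝕜 d n) :=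
  {f | ∀ᵐ x, f x ∈ F x}

/-- The product `F 1_E` of a set valued mapping and an indicator function. -/
def bodyIndicator {𝕜 : Type*} [RCLike 𝕜] {d n : ℕ} (E : Set (Fin d → ℝ))
    (F : (Fin d → ℝ) → Set (EuclideanSpace 𝕜 (Fin n))) :
    (Fin d → ℝ) → Set (EuclideanSpace 𝕜 (Fin n)) :=
  fun x => {v | (x ∈ E ∧ v ∈ F x) ∨ (x ∉ E ∧ v = 0)}

/-! ### Cubes, averages, sparse collections -/

/-- `Q` is a (half-open, non-degenerate) cube with sides parallel to the coordinate axes. -/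
def IsCube {d : ℕ} (Q : Set (Fin d → ℝ)) : Prop :=
  ∃ (a : Fin d → ℝ) (ℓ : ℝ), 0 < ℓ ∧ Q = Set.univ.pi fun i => Set.Ico (a i) (a i + ℓ)

/-- The Aumann average `⟨F⟩_Q = {|Q|⁻¹ ∫_Q f : f ∈ S⁰(ℝᵈ; F)}`. -/
def bodyAverage {𝕜 : Type*} [RCLike 𝕜] {d n : ℕ}
    (F : (Fin d → ℝ) → Set (EuclideanSpace 𝕜 (Fin n))) (Q : Set (Fin d → ℝ)) :
    Set (EuclideanSpace 𝕜 (Fin n)) :=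
  {v | ∃ f ∈ selections F, v = ⨍ x in Q, f x}

/-- The convex body average `⟪f⟫_Q = {|Q|⁻¹ ∫_Q h f : ‖h‖_∞ ≤ 1}`, with scalar functions `h`. -/
def convexBodyAverage {𝕜 : Type*} [RCLike 𝕜] {d n : ℕ} (f : LZero 𝕜 d n)
    (Q : Set (Fin d → ℝ)) : Set (EuclideanSpace 𝕜 (Fin n)) :=
  {v | ∃ h : (Fin d → ℝ) →ₘ[volume] 𝕜, (∀ᵐ x, ‖h x‖ ≤ 1) ∧ v = ⨍ x in Q, h x • f x}

/-- `∑_{Q ∈ S} ⟪f⟫_Q 1_Q(x)`: the closure of the union of all finite partial Minkowski sums. -/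
def convexBodySum {𝕜 : Type*} [RCLike 𝕜] {d n : ℕ} (S : Set (Set (Fin d → ℝ)))
    (f : LZero 𝕜 d n) (x : Fin d → ℝ) : Set (EuclideanSpace 𝕜 (Fin n)) :=
  closure {v | ∃ (A : Finset (Set (Fin d → ℝ))) (u : Set (Fin d → ℝ) → EuclideanSpace 𝕜 (Fin n)),
    (A : Set (Set (Fin d → ℝ))) ⊆ S ∧
    (∀ Q ∈ A, u Q ∈ bodyIndicator Q (fun _ => convexBodyAverage f Q) x) ∧ v = ∑ Q ∈ A, u Q}

/-- A collection of cubes is sparse if there are pairwise disjoint measurable `E_Q ⊆ Q`, `Q ∈ S`,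
with `|E_Q| ≥ |Q| / 2`. -/
def IsSparse {d : ℕ} (S : Set (Set (Fin d → ℝ))) : Prop :=
  (∀ Q ∈ S, IsCube Q) ∧
  ∃ E : Set (Fin d → ℝ) → Set (Fin d → ℝ),
    (∀ Q ∈ S, E Q ⊆ Q ∧ NullMeasurableSet (E Q) volume ∧ volume Q ≤ 2 * volume (E Q)) ∧
    S.PairwiseDisjoint E

/-- A collection of cubes any two of which are nested or disjoint (in particular, one inside a
dyadic grid) is sparse as soon as, for each `Q` in it, the union of the cubes of the collection
that are strictly contained in `Q` has measure at most `|Q| / 2`. -/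
theorem isSparse_of_nested {d : ℕ} {S : Set (Set (Fin d → ℝ))} (hS : ∀ Q ∈ S, IsCube Q)
    (hnest : ∀ Q ∈ S, ∀ Q' ∈ S, Q ⊆ Q' ∨ Q' ⊆ Q ∨ Disjoint Q Q')
    (hmeas : ∀ Q ∈ S, 2 * volume (⋃₀ {Q' | Q' ∈ S ∧ Q' ⊂ Q}) ≤ volume Q) :
    IsSparse S := by
  refine ⟨hS, fun Q => Q \ toMeasurable volume (⋃₀ {Q' | Q' ∈ S ∧ Q' ⊂ Q}), ?_, ?_⟩
  · intro Q hQ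
    have hQm : MeasurableSet Q := by
      obtain ⟨a, ℓ, -, rfl⟩ := hS Q hQ
      exact MeasurableSet.univ_pi fun i => measurableSet_Ico
    have hfin : volume Q ≠ ⊤ := by
      obtain ⟨a, ℓ, -, rfl⟩ := hS Q hQ
      rw [Real.volume_pi_Ico]
      exact ENNReal.prod_ne_top fun i _ => ENNReal.ofReal_ne_top
    refine ⟨sdiff_subset, (hQm.diff (measurableSet_toMeasurable _ _)).nullMeasurableSet, ?_⟩
    have h1 := hmeas Q hQ
    rw [← measure_toMeasurable] at h1
    set B := toMeasurable volume (⋃₀ {Q' | Q' ∈ S ∧ Q' ⊂ Q})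
    have h2 : volume Q ≤ volume (Q \ B) + volume B :=
      (measure_mono (by intro x hx; by_cases h : x ∈ B <;> simp [h, hx])).trans
        (measure_union_le _ _)
    have h3 : volume Q + volume Q ≤ 2 * volume (Q \ B) + volume Q :=
      calc volume Q + volume Q = 2 * volume Q := (two_mul _).symm
        _ ≤ 2 * (volume (Q \ B) + volume B) := by gcongr
        _ = 2 * volume (Q \ B) + 2 * volume B := mul_add _ _ _
        _ ≤ _ := by gcongr
    exact (ENNReal.add_le_add_iff_right hfin).1 h3
  · have key : ∀ Q ∈ S, ∀ Q' : Set (Fin d → ℝ), Q ⊆ Q' → Q ≠ Q' →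
        Disjoint Q (Q' \ toMeasurable volume (⋃₀ {P | P ∈ S ∧ P ⊂ Q'})) := by
      intro Q hQ Q' hsub hne
      refine Set.disjoint_left.2 fun x hx hx' => hx'.2 (subset_toMeasurable _ _ ?_)
      exact Set.mem_sUnion.2 ⟨Q, ⟨hQ, hsub.ssubset_of_ne hne⟩, hx⟩
    intro Q hQ Q' hQ' hne
    rcases hnest Q hQ Q' hQ' with h | h | h
    · exact (key Q hQ Q' h hne).mono_left sdiff_subset
    · exact ((key Q' hQ' Q h hne.symm).mono_left sdiff_subset).symm
    · exact h.mono sdiff_subset sdiff_subset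

/-! ### Directional Banach function spaces -/

/-- An `𝕜ⁿ`-directional Banach function space `X` over `ℝᵈ`. The space is given by its norm,
extended by `∞` to the functions of `L⁰(ℝᵈ; 𝕜ⁿ)` outside `X`; thus `X = {f | nrm f < ∞}`, a
linear subspace on which `nrm` is a norm. -/
structure DirectionalBFS (𝕜 : Type*) [RCLike 𝕜] (d n : ℕ) where
  /-- The extended norm. -/
  nrm : LZero 𝕜 d n → ℝ≥0∞
  eq_zero_of_nrm : ∀ f, nrm f = 0 → f = 0
  nrm_smul : ∀ (c : 𝕜) (f : LZero 𝕜 d n), nrm f < ⊤ → nrm (c • f) = ‖c‖ₑ * nrm f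
  nrm_add_le : ∀ f g, nrm (f + g) ≤ nrm f + nrm g
  nrm_zero : nrm 0 = 0
  /-- Completeness. -/
  complete : ∀ f : ℕ → LZero 𝕜 d n, (∀ k, nrm (f k) < ⊤) →
    (∀ ε : ℝ≥0∞, 0 < ε → ∃ N, ∀ j ≥ N, ∀ k ≥ N, nrm (f j - f k) < ε) →
    ∃ g, nrm g < ⊤ ∧ Tendsto (fun k => nrm (f k - g)) atTop (𝓝 0)
  /-- The directional ideal property. -/
  ideal : ∀ f g : LZero 𝕜 d n, nrm f < ⊤ →
    (∀ᵐ x, symHull 𝕜 {g x} ⊆ symHull 𝕜 {f x}) → nrm g ≤ nrm f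
  /-- Non-degeneracy: if `∫ f · g` exists and vanishes for all `f ∈ X`, then `g = 0`.
  Here `f · g = ∑ₖ fₖ conj(gₖ)`. -/
  nondegenerate : ∀ g : LZero 𝕜 d n,
    (∀ f : LZero 𝕜 d n, nrm f < ⊤ →
      Integrable (fun x => inner 𝕜 (g x) (f x)) ∧ ∫ x, inner 𝕜 (g x) (f x) = 0) →
    g = 0

/-- The (extended) norm of the Köthe dual: `‖g‖_{X'} = sup {∫ |f · g| : ‖f‖_X = 1}`; the space
`X'` is `{g | ‖g‖_{X'} < ∞}`. -/
def kotheDual {𝕜 : Type*} [RCLike 𝕜] {d n : ℕ} (N : LZero 𝕜 d n → ℝ≥0∞) :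
    LZero 𝕜 d n → ℝ≥0∞ :=
  fun g => ⨆ (f : LZero 𝕜 d n) (_ : N f = 1), ∫⁻ x, ‖inner 𝕜 (g x) (f x)‖ₑ

/-- Köthe reflexivity: `X'' = X` with equal norm. -/
def DirectionalBFS.IsKotheReflexive {𝕜 : Type*} [RCLike 𝕜] {d n : ℕ}
    (X : DirectionalBFS 𝕜 d n) : Prop :=
  kotheDual (kotheDual X.nrm) = X.nrm

/-- The (extended) norm of `X[𝒦]`: `‖F‖_{X[𝒦]} = sup {‖f‖_X : f ∈ S⁰(ℝᵈ; F)}`. -/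
def bodyNorm {𝕜 : Type*} [RCLike 𝕜] {d n : ℕ} (N : LZero 𝕜 d n → ℝ≥0∞)
    (F : (Fin d → ℝ) → Set (EuclideanSpace 𝕜 (Fin n))) : ℝ≥0∞ :=
  ⨆ f ∈ selections F, N f

/-- `F ∈ X[𝒦]`: `F ∈ L⁰(ℝᵈ; 𝒦)`, and its selections form a bounded subset of `X`. -/
def MemBodySpace {𝕜 : Type*} [RCLike 𝕜] {d n : ℕ} (N : LZero 𝕜 d n → ℝ≥0∞)
    (F : (Fin d → ℝ) → Set (EuclideanSpace 𝕜 (Fin n))) : Prop :=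
  IsMeasurableBodyMap F ∧ bodyNorm N F < ⊤

/-- `F ∈ L¹_loc(ℝᵈ; 𝒦)`: `F 1_Q ∈ L¹(ℝᵈ; 𝒦)` for all cubes `Q`. -/
def LocIntegrableBody {𝕜 : Type*} [RCLike 𝕜] {d n : ℕ}
    (F : (Fin d → ℝ) → Set (EuclideanSpace 𝕜 (Fin n))) : Prop :=
  IsMeasurableBodyMap F ∧
  ∀ Q, IsCube Q → MemBodySpace (fun f : LZero 𝕜 d n => ∫⁻ x, ‖f x‖ₑ) (bodyIndicator Q F)

/-- The convex-set valued maximal operator: `M F(x)` is the smallest set of the class `𝒦` that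
contains `⟨F⟩_Q` for all cubes `Q ∋ x`. -/
def bodyMaximal {𝕜 : Type*} [RCLike 𝕜] {d n : ℕ}
    (F : (Fin d → ℝ) → Set (EuclideanSpace 𝕜 (Fin n))) :
    (Fin d → ℝ) → Set (EuclideanSpace 𝕜 (Fin n)) :=
  fun x => symHull 𝕜 (⋃ (Q : Set (Fin d → ℝ)) (_ : IsCube Q ∧ x ∈ Q), bodyAverage F Q)

/-- The operator norm `‖M‖_{X[𝒦] → X[𝒦]}`: the least `C` with `‖M F‖ ≤ C ‖F‖` on `X[𝒦]`. -/
def maximalOpNorm {𝕜 : Type*} [RCLike 𝕜] {d n : ℕ} (N : LZero 𝕜 d n → ℝ≥0∞) : ℝ≥0∞ :=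
  sInf {C : ℝ≥0∞ | ∀ F : (Fin d → ℝ) → Set (EuclideanSpace 𝕜 (Fin n)),
    MemBodySpace N F → bodyNorm N (bodyMaximal F) ≤ C * bodyNorm N F}

/-- `M : X[𝒦] → X[𝒦]` is bounded: `M F` is well-defined (i.e., `F ∈ L¹_loc(ℝᵈ; 𝒦)`) and lies in
`X[𝒦]` for all `F ∈ X[𝒦]`, and the operator norm is finite. -/
structure MaximalBounded {𝕜 : Type*} [RCLike 𝕜] {d n : ℕ} (N : LZero 𝕜 d n → ℝ≥0∞) : Prop where
  locIntegrable : ∀ F, MemBodySpace N F → LocIntegrableBody F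
  mapsTo : ∀ F, MemBodySpace N F → MemBodySpace N (bodyMaximal F)
  opNorm_lt_top : maximalOpNorm N < ⊤

/-! ### Convex body domination -/

/-- `L^∞_c(ℝᵈ; 𝕜ⁿ)`: bounded functions with compact support. -/
def LInfCompact (𝕜 : Type*) [RCLike 𝕜] (d n : ℕ) : Set (LZero 𝕜 d n) :=
  {f | (∃ B : ℝ, ∀ᵐ x, ‖f x‖ ≤ B) ∧ ∃ K : Set (Fin d → ℝ), IsCompact K ∧ ∀ᵐ x, x ∉ K → f x = 0}

/-- For every `f ∈ L^∞_c` there is a sparse collection `S` of cubes such that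
`T f(x) ∈ C_T ∑_{Q ∈ S} ⟪f⟫_Q 1_Q(x)` for almost every `x`. -/
def HasConvexBodyDomination {𝕜 : Type*} [RCLike 𝕜] {d n : ℕ}
    (T : LInfCompact 𝕜 d n → LZero 𝕜 d n) (CT : ℝ) : Prop :=
  ∀ f : LInfCompact 𝕜 d n, ∃ S : Set (Set (Fin d → ℝ)), IsSparse S ∧
    ∀ᵐ x, T f x ∈ (CT : 𝕜) • convexBodySum S (f : LZero 𝕜 d n) x

end

/-! By Köthe reflexivity it suffices to bound `∫ |Tf · g|` for `‖g‖_{X'} = 1`. Each body `⟪f⟫_Q` is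
bounded, so up to a factor 2 it is spanned by `n` of its own elements `u_{Q,i}`
(`exists_spanning_family`). Domination then reduces the integral to the sums over `Q` and `i` of
`∫_Q |g · u_{Q,i}|`. Since `u_{Q,i}` is constant on `Q`, a scalar multiplier removes the modulus,
and this integral is `|Q| |v · u_{Q,i}|` for some `v ∈ ⟪g⟫_Q` (`exists_average_inner_eq`). For fixed
`i`, sparseness replaces `|Q|` by `2|E_Q|`. Gluing the `u_{Q,i}` and the `v` along the disjoint
`E_Q` gives functions `φ`, `ψ` that are selections of the maximal functions of `𝒦(f)` and `𝒦(g)`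
(`exists_glued_average`). Hölder's inequality for `X` and `X'` then yields both operator norms
(`tsum_inner_average_le`). -/

/-! ### Symmetric convex sets and the hull of a single vector -/

theorem IsSymConvex.smul_mem {𝕜 : Type*} [RCLike 𝕜] {n : ℕ}
    {K : Set (EuclideanSpace 𝕜 (Fin n))} (hK : IsSymConvex 𝕜 K)
    {v : EuclideanSpace 𝕜 (Fin n)} (hv : v ∈ K) {c : 𝕜} (hc : ‖c‖ ≤ 1) : c • v ∈ K := by
  obtain ⟨e, he, hce⟩ : ∃ e : 𝕜, ‖e‖ = 1 ∧ c = (‖c‖ : 𝕜) * e := by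
    by_cases h : c = 0
    · exact ⟨1, by simp, by simp [h]⟩
    · have h' : (‖c‖ : 𝕜) ≠ 0 := by simpa using h
      exact ⟨c / ‖c‖, by simp [h], by field_simp⟩
  have h1 := hK.symmetric v hv e he
  have h2 := hK.symmetric _ h1 (-1) (by simp)
  -- With weight `t` the segment from `-e • v` to `e • v` passes through `(2t - 1) e • v`; this `t`
  -- gives `‖c‖ e • v`.
  have h3 := hK.convex _ h2 _ h1 ((1 + ‖c‖) / 2) (by positivity) (by linarith)
  convert h3 using 1
  conv_lhs => rw [hce]
  simp only [smul_smul, ← add_smul]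
  congr 1
  push_cast
  ring

theorem IsSymConvex.zero_mem {𝕜 : Type*} [RCLike 𝕜] {n : ℕ}
    {K : Set (EuclideanSpace 𝕜 (Fin n))} (hK : IsSymConvex 𝕜 K) : 0 ∈ K := by
  obtain ⟨v, hv⟩ := hK.nonempty
  simpa using hK.smul_mem hv (c := 0) (by simp)

theorem zero_mem_symHull {𝕜 : Type*} [RCLike 𝕜] {n : ℕ} (B : Set (EuclideanSpace 𝕜 (Fin n))) :
    0 ∈ symHull 𝕜 B :=
  fun _ hK => hK.1.zero_mem

theorem subset_symHull {𝕜 : Type*} [RCLike 𝕜] {n : ℕ} (B : Set (EuclideanSpace 𝕜 (Fin n))) :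
    B ⊆ symHull 𝕜 B :=
  fun _ hv _ hK => hK.2 hv

theorem symHull_singleton_subset {𝕜 : Type*} [RCLike 𝕜] {n : ℕ}
    {B : Set (EuclideanSpace 𝕜 (Fin n))} {w : EuclideanSpace 𝕜 (Fin n)} (hw : w ∈ symHull 𝕜 B) :
    symHull 𝕜 {w} ⊆ symHull 𝕜 B :=
  fun _ hv K hK => hv K ⟨hK.1, singleton_subset_iff.2 (hw K hK)⟩

theorem isSymConvex_image_closedBall {𝕜 : Type*} [RCLike 𝕜] {n : ℕ}
    (v : EuclideanSpace 𝕜 (Fin n)) :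
    IsSymConvex 𝕜 ((fun c : 𝕜 => c • v) '' Metric.closedBall 0 1) where
  nonempty := ⟨_, 0, by simp, rfl⟩
  isClosed := ((isCompact_closedBall _ _).image (by fun_prop)).isClosed
  convex := by
    rintro _ ⟨a, ha, rfl⟩ _ ⟨b, hb, rfl⟩ t ht ht'
    rw [mem_closedBall_zero_iff] at ha hb
    refine ⟨((1 - t : ℝ) : 𝕜) * a + (t : 𝕜) * b, ?_, by simp [add_smul, mul_smul]⟩
    rw [mem_closedBall_zero_iff]
    refine (norm_add_le _ _).trans ?_
    rw [norm_mul, norm_mul, RCLike.norm_ofReal, RCLike.norm_ofReal, abs_of_nonneg ht,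
      abs_of_nonneg (by linarith)]
    nlinarith
  symmetric := by
    rintro _ ⟨a, ha, rfl⟩ c hc
    exact ⟨c * a, by simpa [hc] using ha, by simp [mul_smul]⟩

theorem symHull_singleton {𝕜 : Type*} [RCLike 𝕜] {n : ℕ} (v : EuclideanSpace 𝕜 (Fin n)) :
    symHull 𝕜 {v} = (fun c : 𝕜 => c • v) '' Metric.closedBall 0 1 := by
  refine Subset.antisymm ?_ ?_
  · exact sInter_subset_of_mem
      ⟨isSymConvex_image_closedBall v, singleton_subset_iff.2 ⟨1, by simp, by simp⟩⟩
  · rintro _ ⟨c, hc, rfl⟩ K hK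
    exact hK.1.smul_mem (hK.2 rfl) (by simpa using hc)

/-- As `U` is open and `c ↦ c • f x` is continuous, countably many scalars dense in the unit ball
detect whether the hull meets `U`. -/
theorem isMeasurableBodyMap_symHull_singleton {𝕜 : Type*} [RCLike 𝕜] {d n : ℕ}
    (f : LZero 𝕜 d n) : IsMeasurableBodyMap fun x => symHull 𝕜 {f x} where
  mem x := symHull_singleton (f x) ▸ isSymConvex_image_closedBall _
  measurable U hU := by
    have : Nonempty (Metric.closedBall (0 : 𝕜) 1) := ⟨0, by simp⟩
    have : {x | (symHull 𝕜 {f x} ∩ U).Nonempty} =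
        ⋃ k : ℕ, (fun x => (TopologicalSpace.denseSeq (Metric.closedBall (0 : 𝕜) 1) k : 𝕜) •
          f x) ⁻¹' U := by
      ext x
      simp only [mem_ofPred_eq, symHull_singleton, mem_iUnion, mem_preimage]
      constructor
      · rintro ⟨_, ⟨c, hc, rfl⟩, hcU⟩
        have ho : IsOpen {c : Metric.closedBall (0 : 𝕜) 1 | (c : 𝕜) • f x ∈ U} :=
          hU.preimage (by fun_prop)
        obtain ⟨_, hy, k, rfl⟩ := (TopologicalSpace.denseRange_denseSeq
          (Metric.closedBall (0 : 𝕜) 1)).inter_open_nonempty _ ho ⟨⟨c, hc⟩, hcU⟩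
        exact ⟨k, hy⟩
      · rintro ⟨k, hk⟩
        exact ⟨_, ⟨_, Subtype.coe_prop _, rfl⟩, hk⟩
    rw [this]
    refine NullMeasurableSet.iUnion fun k => ?_
    have hm : AEStronglyMeasurable (fun x => (TopologicalSpace.denseSeq
        (Metric.closedBall (0 : 𝕜) 1) k : 𝕜) • f x) volume :=
      f.aestronglyMeasurable.const_smul
        (TopologicalSpace.denseSeq (Metric.closedBall (0 : 𝕜) 1) k : 𝕜)
    exact hm.aemeasurable.nullMeasurableSet_preimage
      hU.measurableSet

/-! ### Spanning a bounded set by few of its elements -/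

/-- A bounded set in a finite dimensional space is contained, up to a factor `2`, in the
absolutely convex parallelepiped spanned by some of its elements. -/
theorem exists_spanning_family {𝕜 V : Type*} [RCLike 𝕜] [NormedAddCommGroup V] [NormedSpace 𝕜 V]
    [FiniteDimensional 𝕜 V] {K : Set V} (hne : K.Nonempty) (hK : Bornology.IsBounded K) {n : ℕ}
    (hn : Module.finrank 𝕜 V ≤ n) :
    ∃ u : Fin n → V, (∀ i, u i ∈ K) ∧
      ∀ v ∈ K, ∃ c : Fin n → 𝕜, (∀ i, ‖c i‖ ≤ 2) ∧ v = ∑ i, c i • u i := by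
  classical
  obtain ⟨b, hbK, hspan, hli⟩ := exists_linearIndependent 𝕜 K
  have : Finite b := hli.finite
  have : Fintype b := Fintype.ofFinite b
  have hspan' : Submodule.span 𝕜 (range ((↑) : b → V)) = Submodule.span 𝕜 K := by
    rw [Subtype.range_coe, hspan]
  set W := Submodule.span 𝕜 (range ((↑) : b → V))
  have hKW : ∀ v ∈ K, v ∈ W := fun v hv => hspan' ▸ Submodule.subset_span hv
  let B : Module.Basis b 𝕜 W := Module.Basis.span hli
  let P : Set (b → W) := {u | ∀ i, (u i : V) ∈ K}
  have hP : Bornology.IsBounded P := by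
    obtain ⟨R, hR⟩ := hK.exists_norm_le
    refine (isBounded_iff_forall_norm_le.2 ⟨max R 0, fun u hu => ?_⟩)
    exact (pi_norm_le_iff_of_nonneg (le_max_right _ _)).2 fun i =>
      (hR _ (hu i)).trans (le_max_left _ _)
  have hcont : Continuous fun u : b → W => ‖B.det u‖ := by
    have : Continuous fun u : b → W => B.det u := by
      simp only [Module.Basis.det_apply]
      refine Continuous.matrix_det ?_
      refine continuous_matrix fun i j => ?_
      simp only [Module.Basis.toMatrix_apply]
      exact (LinearMap.continuous_of_finiteDimensional (B.coord i)).comp (continuous_apply j)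
    exact this.norm
  have hbdd : BddAbove ((fun u : b → W => ‖B.det u‖) '' P) := by
    have : ProperSpace (b → W) := FiniteDimensional.proper 𝕜 _
    refine BddAbove.mono (image_mono subset_closure)
      (IsCompact.bddAbove (IsCompact.image hP.isCompact_closure hcont))
  set s := sSup ((fun u : b → W => ‖B.det u‖) '' P)
  have hBP : (B : b → W) ∈ P := fun i => by
    have : ((B i : W) : V) = i := congrArg Subtype.val (Module.Basis.span_apply hli i)
    rw [this]; exact hbK i.2
  have hs : 1 ≤ s := by
    refine le_csSup hbdd ⟨B, hBP, ?_⟩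
    simp [Module.Basis.det_self]
  -- `K` need not be closed, so the largest determinant may not be attained; getting within a factor
  -- 2 of it is what produces the bound 2 on the coefficients.
  obtain ⟨_, ⟨u, huP, rfl⟩, hu⟩ := exists_lt_of_lt_csSup (⟨_, B, hBP, rfl⟩ :
    ((fun u : b → W => ‖B.det u‖) '' P).Nonempty) (show s / 2 < s by linarith)
  simp only at hu
  have hdet : B.det u ≠ 0 := by
    intro h
    rw [h, norm_zero] at hu
    linarith
  obtain ⟨hliu, hspu⟩ := (B.is_basis_iff_det).2 (isUnit_iff_ne_zero.2 hdet)
  let B' : Module.Basis b 𝕜 W := Module.Basis.mk hliu hspu.ge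
  have hB' : ∀ i, B' i = u i := fun i => by simp [B']
  have hcoef : ∀ v : W, (v : V) ∈ K → ∀ i, ‖B'.repr v i‖ ≤ 2 := by
    intro v hv i
    -- Cramer's rule: replacing `u i` by `v ∈ K` stays in `P`, so the new determinant is at most `s
    -- < 2 ‖B.det u‖`.
    have h1 : B.det (Function.update u i v) = B'.repr v i * B.det u := by
      have h : v = ∑ j, B'.repr v j • u j := by
        conv_lhs => rw [← B'.sum_repr v]
        simp [hB']
      conv_lhs => rw [h]
      rw [AlternatingMap.map_update_sum]
      rw [Finset.sum_eq_single i]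
      · rw [AlternatingMap.map_update_smul, Function.update_eq_self, smul_eq_mul]
      · intro j _ hj
        rw [AlternatingMap.map_update_smul, AlternatingMap.map_update_self _ _ hj.symm, smul_zero]
      · simp
    have h2 : ‖B.det (Function.update u i v)‖ ≤ s := by
      refine le_csSup hbdd ⟨_, ?_, rfl⟩
      intro j
      by_cases h : j = i
      · subst h; simpa using hv
      · simpa [h] using huP j
    rw [h1, norm_mul] at h2
    by_contra! h3
    nlinarith [norm_nonneg (B'.repr v i)]
  have hcard : Fintype.card b ≤ n := (hli.fintype_card_le_finrank).trans hn
  obtain ⟨e⟩ : Nonempty (b ↪ Fin n) :=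
    Function.Embedding.nonempty_of_card_le (by simpa using hcard)
  obtain ⟨v₀, hv₀⟩ := hne
  -- The family is padded to length `n` by `v₀ ∈ K`, with coefficient 0.
  refine ⟨Function.extend e (fun i => (u i : V)) fun _ => v₀, fun i => ?_, fun v hv => ?_⟩
  · by_cases h : ∃ j, e j = i
    · obtain ⟨j, rfl⟩ := h
      rw [e.injective.extend_apply]; exact huP j
    · rwa [Function.extend_apply' _ _ _ h]
  · refine ⟨Function.extend e (B'.repr ⟨v, hKW v hv⟩) 0, fun i => ?_, ?_⟩
    · by_cases h : ∃ j, e j = i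
      · obtain ⟨j, rfl⟩ := h
        rw [e.injective.extend_apply]; exact hcoef _ hv j
      · simp [Function.extend_apply' _ _ _ h]
    · have h := congrArg (Subtype.val : W → V) (B'.sum_repr ⟨v, hKW v hv⟩)
      rw [← Finset.sum_subset (Finset.subset_univ (Finset.univ.map e))]
      · rw [Finset.sum_map]
        simp only [e.injective.extend_apply]
        simpa [hB'] using h.symm
      · intro i _ hi
        have : ¬ ∃ j, e j = i := by simpa using hi
        simp [Function.extend_apply' _ _ _ this]

/-! ### Cubes, sparse collections and gluing -/

theorem IsCube.measurableSet {d : ℕ} {Q : Set (Fin d → ℝ)} (hQ : IsCube Q) : MeasurableSet Q := by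
  obtain ⟨a, ℓ, -, rfl⟩ := hQ
  exact MeasurableSet.univ_pi fun i => measurableSet_Ico

theorem IsCube.volume_ne_top {d : ℕ} {Q : Set (Fin d → ℝ)} (hQ : IsCube Q) : volume Q ≠ ⊤ := by
  obtain ⟨a, ℓ, -, rfl⟩ := hQ
  rw [Real.volume_pi_Ico]
  exact ENNReal.prod_ne_top fun i _ => ENNReal.ofReal_ne_top

theorem IsCube.volume_ne_zero {d : ℕ} {Q : Set (Fin d → ℝ)} (hQ : IsCube Q) : volume Q ≠ 0 := by
  obtain ⟨a, ℓ, hℓ, rfl⟩ := hQ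
  rw [Real.volume_pi_Ico]
  exact Finset.prod_ne_zero_iff.2 fun i _ => by simpa using hℓ

/-- The `E Q` are disjoint with positive measure, and Lebesgue measure is `σ`-finite. -/
theorem IsSparse.countable {d : ℕ} {S : Set (Set (Fin d → ℝ))} (hS : IsSparse S) :
    S.Countable := by
  obtain ⟨hcube, E, hE, hdisj⟩ := hS
  have h := Measure.countable_meas_pos_of_disjoint_iUnion₀ (μ := volume)
    (As := fun Q : S => E Q) (fun Q => (hE Q Q.2).2.1) fun Q Q' hne =>
      (hdisj Q.2 Q'.2 fun h => hne (Subtype.ext h)).aedisjoint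
  rw [← Set.countable_coe_iff, ← Set.countable_univ_iff]
  refine h.mono fun Q _ => ?_
  have h1 := (hE Q Q.2).2.2
  change 0 < volume (E Q)
  refine pos_iff_ne_zero.2 fun h0 => (hcube Q Q.2).volume_ne_zero ?_
  simpa [h0] using h1

/-- Gluing constants along a countable disjoint family. -/
theorem exists_aestronglyMeasurable_piecewise {α V ι : Type*} [MeasurableSpace α] {μ : Measure α}
    [TopologicalSpace V] [TopologicalSpace.PseudoMetrizableSpace V] [Zero V] [Countable ι]
    (E : ι → Set α)
    (hE : ∀ i, NullMeasurableSet (E i) μ) (hdisj : Pairwise (Function.onFun Disjoint E))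
    (w : ι → V) :
    ∃ φ : α → V, AEStronglyMeasurable φ μ ∧ (∀ i, ∀ x ∈ E i, φ x = w i) ∧
      ∀ x, (∀ i, x ∉ E i) → φ x = 0 := by
  classical
  let φ : α → V := fun x => if h : ∃ i, x ∈ E i then w h.choose else 0
  have h1 : ∀ i, ∀ x ∈ E i, φ x = w i := by
    intro i x hx
    have h : ∃ i, x ∈ E i := ⟨i, hx⟩
    simp only [φ, dif_pos h]
    congr 1
    by_contra hne
    exact Set.disjoint_left.1 (hdisj hne) h.choose_spec hx
  have h2 : ∀ x, (∀ i, x ∉ E i) → φ x = 0 := fun x hx => by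
    simp only [φ]; rw [dif_neg (by simpa using hx)]
  refine ⟨φ, ?_, h1, h2⟩
  have h3 : φ = (⋃ i, E i).indicator φ := by
    refine (Set.indicator_eq_self.2 fun x hx => ?_).symm
    by_contra h
    exact hx (h2 x (by simpa using h))
  rw [h3, aestronglyMeasurable_indicator_iff₀ (NullMeasurableSet.iUnion hE),
    aestronglyMeasurable_iUnion_iff]
  intro i
  refine (aestronglyMeasurable_const (b := w i)).congr ?_
  filter_upwards [ae_restrict_mem₀ (hE i)] with x hx
  exact (h1 i x hx).symm

/-! ### The maximal operator on the bodies `𝒦(f)` -/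

/-- The infimum defining the operator norm is itself an admissible constant; its finiteness covers
the case `bodyNorm N F = 0` in the division. -/
theorem bodyNorm_bodyMaximal_le {𝕜 : Type*} [RCLike 𝕜] {d n : ℕ} {N : LZero 𝕜 d n → ℝ≥0∞}
    {F : (Fin d → ℝ) → Set (EuclideanSpace 𝕜 (Fin n))} (hM : maximalOpNorm N < ⊤)
    (hF : MemBodySpace N F) : bodyNorm N (bodyMaximal F) ≤ maximalOpNorm N * bodyNorm N F := by
  rw [← ENNReal.div_le_iff_le_mul (Or.inr hM.ne) (Or.inl hF.2.ne)]
  exact le_sInf fun C hC => ENNReal.div_le_of_le_mul (hC F hF)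

theorem memBodySpace_symHull_singleton {𝕜 : Type*} [RCLike 𝕜] {d n : ℕ}
    {N : LZero 𝕜 d n → ℝ≥0∞} {f : LZero 𝕜 d n}
    (hN : ∀ g : LZero 𝕜 d n, (∀ᵐ x, g x ∈ symHull 𝕜 {f x}) → N g ≤ N f) (hf : N f < ⊤) :
    MemBodySpace N fun x => symHull 𝕜 {f x} :=
  ⟨isMeasurableBodyMap_symHull_singleton f, (iSup₂_le hN).trans_lt hf⟩

theorem convexBodyAverage_subset_bodyAverage {𝕜 : Type*} [RCLike 𝕜] {d n : ℕ} (f : LZero 𝕜 d n)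
    (Q : Set (Fin d → ℝ)) :
    convexBodyAverage f Q ⊆ bodyAverage (fun x => symHull 𝕜 {f x}) Q := by
  rintro v ⟨h, hh, rfl⟩
  have hm : AEStronglyMeasurable (fun x => h x • f x) volume :=
    h.aestronglyMeasurable.smul f.aestronglyMeasurable
  refine ⟨AEEqFun.mk _ hm, ?_, ?_⟩
  · filter_upwards [hh, AEEqFun.coeFn_mk _ hm] with x hx hx'
    rw [hx', symHull_singleton]
    exact ⟨h x, by simpa using hx, rfl⟩
  · refine average_congr (ae_restrict_of_ae ?_)
    filter_upwards [AEEqFun.coeFn_mk _ hm] with x hx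
    exact hx.symm

/-- Elements of the averages of `f` over cubes `Q`, glued along disjoint subsets of the cubes,
form a function that is controlled by the maximal function of `f`. -/
theorem exists_glued_average {𝕜 ι : Type*} [RCLike 𝕜] [Countable ι] {d n : ℕ}
    {N : LZero 𝕜 d n → ℝ≥0∞} (hM : maximalOpNorm N < ⊤) {f : LZero 𝕜 d n}
    (hN : ∀ g : LZero 𝕜 d n, (∀ᵐ x, g x ∈ symHull 𝕜 {f x}) → N g ≤ N f) (hf : N f < ⊤)
    {Q E : ι → Set (Fin d → ℝ)} (hQ : ∀ i, IsCube (Q i)) (hEQ : ∀ i, E i ⊆ Q i)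
    (hE : ∀ i, NullMeasurableSet (E i) volume) (hdisj : Pairwise (Function.onFun Disjoint E))
    {w : ι → EuclideanSpace 𝕜 (Fin n)} (hw : ∀ i, w i ∈ convexBodyAverage f (Q i)) :
    ∃ φ : LZero 𝕜 d n, N φ ≤ maximalOpNorm N * N f ∧ ∀ᵐ x, ∀ i, x ∈ E i → φ x = w i := by
  obtain ⟨φ, hφm, hφ, hφ0⟩ := exists_aestronglyMeasurable_piecewise E hE hdisj w
  have hmem := memBodySpace_symHull_singleton hN hf
  refine ⟨AEEqFun.mk φ hφm, ?_, ?_⟩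
  · calc N (AEEqFun.mk φ hφm) ≤ bodyNorm N (bodyMaximal fun x => symHull 𝕜 {f x}) := by
          -- The glued function is a selection of the maximal function: on `E i ⊆ Q i` its value
          -- lies in an average over a cube containing `x`, and elsewhere it is 0.
          refine le_iSup₂_of_le (AEEqFun.mk φ hφm) ?_ le_rfl
          filter_upwards [AEEqFun.coeFn_mk φ hφm] with x hx
          rw [hx]
          by_cases h : ∃ i, x ∈ E i
          · obtain ⟨i, hi⟩ := h
            rw [hφ i x hi]
            exact subset_symHull _ (mem_iUnion₂.2 ⟨Q i, ⟨hQ i, hEQ i hi⟩,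
              convexBodyAverage_subset_bodyAverage f _ (hw i)⟩)
          · rw [hφ0 x (by simpa using h)]
            exact zero_mem_symHull _
      _ ≤ maximalOpNorm N * bodyNorm N fun x => symHull 𝕜 {f x} := bodyNorm_bodyMaximal_le hM hmem
      _ ≤ maximalOpNorm N * N f := by gcongr; exact iSup₂_le hN
  · filter_upwards [AEEqFun.coeFn_mk φ hφm] with x hx i hi
    rw [hx, hφ i x hi]

/-! ### Ideal property and Hölder's inequality for `X` and its Köthe dual -/

theorem DirectionalBFS.nrm_le_of_mem_symHull {𝕜 : Type*} [RCLike 𝕜] {d n : ℕ}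
    (X : DirectionalBFS 𝕜 d n) {f : LZero 𝕜 d n} (hf : X.nrm f < ⊤) (g : LZero 𝕜 d n)
    (hg : ∀ᵐ x, g x ∈ symHull 𝕜 {f x}) : X.nrm g ≤ X.nrm f := by
  refine X.ideal f g hf ?_
  filter_upwards [hg] with x hx using symHull_singleton_subset hx

/-- Pointwise `g = c f` with `|c| ≤ 1`, so every pairing with `g` is dominated by that with `f`. -/
theorem kotheDual_le_of_mem_symHull {𝕜 : Type*} [RCLike 𝕜] {d n : ℕ}
    (N : LZero 𝕜 d n → ℝ≥0∞) {f : LZero 𝕜 d n} (g : LZero 𝕜 d n)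
    (hg : ∀ᵐ x, g x ∈ symHull 𝕜 {f x}) : kotheDual N g ≤ kotheDual N f := by
  refine iSup₂_mono fun k _ => lintegral_mono_ae ?_
  filter_upwards [hg] with x hx
  rw [symHull_singleton] at hx
  obtain ⟨c, hc, hcx⟩ := hx
  rw [← hcx, inner_smul_left, enorm_mul]
  refine mul_le_of_le_one_left' ?_
  rw [← ofReal_norm, RCLike.norm_conj, ENNReal.ofReal_le_one]
  simpa using hc

theorem DirectionalBFS.lintegral_inner_le {𝕜 : Type*} [RCLike 𝕜] {d n : ℕ}
    (X : DirectionalBFS 𝕜 d n) {φ : LZero 𝕜 d n} (hφ : X.nrm φ < ⊤) (ψ : LZero 𝕜 d n) :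
    ∫⁻ x, ‖inner 𝕜 (ψ x) (φ x)‖ₑ ≤ X.nrm φ * kotheDual X.nrm ψ := by
  -- The dual norm tests only functions of norm exactly 1, so `φ` is normalised and `φ = 0` is
  -- treated apart.
  by_cases h0 : X.nrm φ = 0
  · have : ∫⁻ x, ‖inner 𝕜 (ψ x) (φ x)‖ₑ = 0 := by
      rw [X.eq_zero_of_nrm φ h0, ← lintegral_zero]
      refine lintegral_congr_ae ?_
      filter_upwards [AEEqFun.coeFn_zero (α := Fin d → ℝ) (β := EuclideanSpace 𝕜 (Fin n))
        (μ := volume)] with x hx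
      simp [hx]
    simp [this]
  · set c : 𝕜 := (((X.nrm φ).toReal⁻¹ : ℝ) : 𝕜)
    have hpos : 0 < (X.nrm φ).toReal := ENNReal.toReal_pos h0 hφ.ne
    have hc : ‖c‖ₑ = (X.nrm φ)⁻¹ := by
      rw [← ofReal_norm, RCLike.norm_ofReal, abs_of_pos (inv_pos.2 hpos),
        ENNReal.ofReal_inv_of_pos hpos, ENNReal.ofReal_toReal hφ.ne]
    have h1 : X.nrm (c • φ) = 1 := by
      rw [X.nrm_smul _ _ hφ, hc, ENNReal.inv_mul_cancel h0 hφ.ne]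
    have h2 : ∫⁻ x, ‖inner 𝕜 (ψ x) ((c • φ : LZero 𝕜 d n) x)‖ₑ ≤ kotheDual X.nrm ψ :=
      le_iSup₂_of_le (c • φ) h1 le_rfl
    have h3 : ∫⁻ x, ‖inner 𝕜 (ψ x) ((c • φ : LZero 𝕜 d n) x)‖ₑ =
        (X.nrm φ)⁻¹ * ∫⁻ x, ‖inner 𝕜 (ψ x) (φ x)‖ₑ := by
      rw [← hc, ← lintegral_const_mul' _ _ enorm_ne_top]
      refine lintegral_congr_ae ?_
      filter_upwards [AEEqFun.coeFn_smul c φ] with x hx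
      rw [hx, Pi.smul_apply, inner_smul_right, enorm_mul]
    rw [h3, ENNReal.inv_mul_le_iff h0 hφ.ne] at h2
    exact h2

/-! ### The sparse form -/

/-- The sparse form is bounded by the maximal operators on `X` and on its Köthe dual. -/
theorem tsum_inner_average_le {𝕜 ι : Type*} [RCLike 𝕜] [Countable ι] {d n : ℕ}
    (X : DirectionalBFS 𝕜 d n) (hM : maximalOpNorm X.nrm < ⊤)
    (hM' : maximalOpNorm (kotheDual X.nrm) < ⊤) {f g : LZero 𝕜 d n} (hf : X.nrm f < ⊤) (hg : kotheDual X.nrm g < ⊤)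
    {Q E : ι → Set (Fin d → ℝ)} (hQ : ∀ i, IsCube (Q i)) (hEQ : ∀ i, E i ⊆ Q i)
    (hE : ∀ i, NullMeasurableSet (E i) volume) (hdisj : Pairwise (Function.onFun Disjoint E))
    (hvol : ∀ i, volume (Q i) ≤ 2 * volume (E i))
    {u v : ι → EuclideanSpace 𝕜 (Fin n)} (hu : ∀ i, u i ∈ convexBodyAverage f (Q i))
    (hv : ∀ i, v i ∈ convexBodyAverage g (Q i)) :
    ∑' i, volume (Q i) * ‖inner 𝕜 (v i) (u i)‖ₑ ≤
      2 * ((maximalOpNorm X.nrm * X.nrm f) *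
        (maximalOpNorm (kotheDual X.nrm) * kotheDual X.nrm g)) := by
  obtain ⟨φ, hφ, hφE⟩ := exists_glued_average hM (X.nrm_le_of_mem_symHull hf) hf hQ hEQ hE hdisj hu
  obtain ⟨ψ, hψ, hψE⟩ :=
    exists_glued_average hM' (kotheDual_le_of_mem_symHull X.nrm) hg hQ hEQ hE hdisj hv
  have hφt : X.nrm φ < ⊤ := hφ.trans_lt (ENNReal.mul_lt_top hM hf)
  calc ∑' i, volume (Q i) * ‖inner 𝕜 (v i) (u i)‖ₑ
      ≤ ∑' i, 2 * ∫⁻ x in E i, ‖inner 𝕜 (ψ x) (φ x)‖ₑ := by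
        refine ENNReal.tsum_le_tsum fun i => ?_
        have : ∫⁻ x in E i, ‖inner 𝕜 (ψ x) (φ x)‖ₑ = ‖inner 𝕜 (v i) (u i)‖ₑ * volume (E i) := by
          rw [← setLIntegral_const]
          refine lintegral_congr_ae ?_
          filter_upwards [ae_restrict_mem₀ (hE i), ae_restrict_of_ae hφE,
            ae_restrict_of_ae hψE] with x hx h1 h2
          rw [h1 i hx, h2 i hx]
        rw [this, mul_comm ‖_‖ₑ, ← mul_assoc]
        gcongr
        exact hvol i
    _ = 2 * ∫⁻ x in ⋃ i, E i, ‖inner 𝕜 (ψ x) (φ x)‖ₑ := by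
        rw [ENNReal.tsum_mul_left, lintegral_iUnion₀ hE fun i j hij => (hdisj hij).aedisjoint]
    _ ≤ 2 * ∫⁻ x, ‖inner 𝕜 (ψ x) (φ x)‖ₑ := by gcongr; exact Measure.restrict_le_self
    _ ≤ 2 * (X.nrm φ * kotheDual X.nrm ψ) := by gcongr; exact X.lintegral_inner_le hφt ψ
    _ ≤ _ := by gcongr

/-! ### Integrals over cubes as pairings with averages -/

/-- `g 1_Q` is a selection of `𝒦(g) 1_Q`, whose selections are bounded in `L¹`. -/
theorem integrableOn_of_maximalBounded {𝕜 : Type*} [RCLike 𝕜] {d n : ℕ}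
    {N : LZero 𝕜 d n → ℝ≥0∞} (hM : MaximalBounded N) {g : LZero 𝕜 d n}
    (hN : ∀ h : LZero 𝕜 d n, (∀ᵐ x, h x ∈ symHull 𝕜 {g x}) → N h ≤ N g) (hg : N g < ⊤)
    {Q : Set (Fin d → ℝ)} (hQ : IsCube Q) : IntegrableOn g Q := by
  have h := ((hM.locIntegrable _ (memBodySpace_symHull_singleton hN hg)).2 Q hQ).2
  have hm : AEStronglyMeasurable (Q.indicator g) volume :=
    g.aestronglyMeasurable.indicator hQ.measurableSet
  have h2 : ∫⁻ x, ‖(AEEqFun.mk _ hm : LZero 𝕜 d n) x‖ₑ < ⊤ := by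
    refine lt_of_le_of_lt (le_iSup₂_of_le (AEEqFun.mk _ hm) ?_ le_rfl) h
    filter_upwards [AEEqFun.coeFn_mk _ hm] with x hx
    rw [hx]
    by_cases hxQ : x ∈ Q
    · exact Or.inl ⟨hxQ, by rw [indicator_of_mem hxQ]; exact subset_symHull _ rfl⟩
    · exact Or.inr ⟨hxQ, by rw [indicator_of_notMem hxQ]⟩
  rw [← integrable_indicator_iff hQ.measurableSet]
  refine ⟨hm, ?_⟩
  rw [HasFiniteIntegral]
  refine lt_of_le_of_lt (le_of_eq (lintegral_congr_ae ?_)) h2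
  filter_upwards [AEEqFun.coeFn_mk _ hm] with x hx
  rw [hx]

/-- The multiplier `h = conj z / |z|` with `z = inner 𝕜 u (g x)` turns `z` into `|z|`; where `z =
0`, division by zero gives `h = 0`. The modulus gone, the constant `u` comes out of the integral. -/
theorem exists_average_inner_eq {𝕜 : Type*} [RCLike 𝕜] {d n : ℕ} {g : LZero 𝕜 d n}
    {Q : Set (Fin d → ℝ)} (hQ : IsCube Q) (hg : IntegrableOn g Q)
    (u : EuclideanSpace 𝕜 (Fin n)) :
    ∃ v ∈ convexBodyAverage g Q,
      ∫⁻ x in Q, ‖inner 𝕜 (g x) u‖ₑ = volume Q * ‖inner 𝕜 v u‖ₑ := by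
  have hzm : AEMeasurable (fun x => inner 𝕜 u (g x)) volume :=
    (aestronglyMeasurable_const.inner g.aestronglyMeasurable).aemeasurable
  have hm : AEStronglyMeasurable
      (fun x => (starRingEnd 𝕜) (inner 𝕜 u (g x)) / (‖inner 𝕜 u (g x)‖ : 𝕜)) volume := by
    have h1 : Measurable fun z : 𝕜 => (starRingEnd 𝕜) z / (‖z‖ : 𝕜) :=
      (RCLike.continuous_conj.measurable).div
        ((RCLike.continuous_ofReal.comp continuous_norm).measurable)
    exact (h1.comp_aemeasurable hzm).aestronglyMeasurable
  set h : (Fin d → ℝ) →ₘ[volume] 𝕜 := AEEqFun.mk _ hm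
  have hh : ∀ᵐ x, h x = (starRingEnd 𝕜) (inner 𝕜 u (g x)) / (‖inner 𝕜 u (g x)‖ : 𝕜) :=
    AEEqFun.coeFn_mk _ hm
  have hh1 : ∀ᵐ x, ‖h x‖ ≤ 1 := by
    filter_upwards [hh] with x hx
    rw [hx, norm_div, RCLike.norm_conj, RCLike.norm_ofReal, abs_norm]
    exact div_self_le_one _
  have hint : IntegrableOn (fun x => h x • g x) Q :=
    hg.bdd_smul 1 h.aestronglyMeasurable.restrict (ae_restrict_of_ae hh1)
  refine ⟨_, ⟨h, hh1, rfl⟩, ?_⟩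
  have h1 : ∀ᵐ x, inner 𝕜 u (h x • g x) = ((‖inner 𝕜 (g x) u‖ : ℝ) : 𝕜) := by
    filter_upwards [hh] with x hx
    rw [inner_smul_right, hx, norm_inner_symm (g x) u]
    by_cases h0 : inner 𝕜 u (g x) = 0
    · simp [h0]
    · have : (‖inner 𝕜 u (g x)‖ : 𝕜) ≠ 0 := by simpa using h0
      rw [div_mul_eq_mul_div, RCLike.conj_mul]
      field_simp
  have hgi : IntegrableOn (fun x => ‖inner 𝕜 (g x) u‖) Q := (hg.inner_const u).norm
  have h2 : inner 𝕜 u (⨍ x in Q, h x • g x) =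
      (((volume.real Q)⁻¹ * ∫ x in Q, ‖inner 𝕜 (g x) u‖ : ℝ) : 𝕜) := by
    rw [setAverage_eq, RCLike.real_smul_eq_coe_smul (K := 𝕜), inner_smul_right, ← integral_inner hint,
      integral_congr_ae (ae_restrict_of_ae h1), integral_ofReal]
    push_cast
    rfl
  have hpos : 0 < volume.real Q := ENNReal.toReal_pos hQ.volume_ne_zero hQ.volume_ne_top
  rw [← ofReal_norm (inner 𝕜 _ u), norm_inner_symm, h2, RCLike.norm_ofReal, abs_of_nonneg
    (by positivity), ENNReal.ofReal_mul (by positivity), ENNReal.ofReal_inv_of_pos hpos,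
    measureReal_def, ENNReal.ofReal_toReal hQ.volume_ne_top, ← mul_assoc,
    ENNReal.mul_inv_cancel hQ.volume_ne_zero hQ.volume_ne_top, one_mul,
    ofReal_integral_eq_lintegral_ofReal hgi (Eventually.of_forall fun _ => norm_nonneg _)]
  simp only [ofReal_norm]

/-! ### Convex body averages and their sparse sums -/

theorem zero_mem_convexBodyAverage {𝕜 : Type*} [RCLike 𝕜] {d n : ℕ} (f : LZero 𝕜 d n)
    (Q : Set (Fin d → ℝ)) : 0 ∈ convexBodyAverage f Q := by
  have h0 := AEEqFun.coeFn_zero (α := Fin d → ℝ) (β := 𝕜) (μ := volume)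
  refine ⟨0, ?_, ?_⟩
  · filter_upwards [h0] with x hx
    simp [hx]
  · rw [average_congr (g := fun _ => (0 : EuclideanSpace 𝕜 (Fin n)))]
    · simp [average]
    · filter_upwards [ae_restrict_of_ae h0] with x hx
      simp [hx]

theorem isBounded_convexBodyAverage {𝕜 : Type*} [RCLike 𝕜] {d n : ℕ} {f : LZero 𝕜 d n} {B : ℝ}
    (hf : ∀ᵐ x, ‖f x‖ ≤ B) {Q : Set (Fin d → ℝ)} (hQ : IsCube Q) :
    Bornology.IsBounded (convexBodyAverage f Q) := by
  refine isBounded_iff_forall_norm_le.2 ⟨(volume.real Q)⁻¹ * (B * volume.real Q), ?_⟩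
  rintro _ ⟨h, hh, rfl⟩
  rw [setAverage_eq, norm_smul, Real.norm_of_nonneg (by positivity)]
  gcongr
  refine norm_setIntegral_le_of_norm_le_const_ae hQ.volume_ne_top.lt_top ?_
  filter_upwards [ae_restrict_of_ae hf, ae_restrict_of_ae hh] with x h1 h2
  rw [norm_smul]
  exact (mul_le_of_le_one_left (norm_nonneg _) h2).trans h1

/-- Pairing an element of a sparse sum of convex bodies with a vector `w`. -/
theorem enorm_inner_le_of_mem_convexBodySum {𝕜 : Type*} [RCLike 𝕜] {d n : ℕ}
    {S : Set (Set (Fin d → ℝ))} {f : LZero 𝕜 d n} {x : Fin d → ℝ}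
    {y w : EuclideanSpace 𝕜 (Fin n)} (hy : y ∈ convexBodySum S f x)
    (u : S → Fin n → EuclideanSpace 𝕜 (Fin n))
    (hu : ∀ Q : S, ∀ v ∈ convexBodyAverage f Q,
      ∃ c : Fin n → 𝕜, (∀ i, ‖c i‖ ≤ 2) ∧ v = ∑ i, c i • u Q i) :
    ‖inner 𝕜 y w‖ₑ ≤ ∑' Q : S, (Q : Set (Fin d → ℝ)).indicator
      (fun _ => 2 * ∑ i, ‖inner 𝕜 w (u Q i)‖ₑ) x := by
  set R : ℝ≥0∞ := ∑' Q : S, (Q : Set (Fin d → ℝ)).indicator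
      (fun _ => 2 * ∑ i, ‖inner 𝕜 w (u Q i)‖ₑ) x
  -- The bound is a closed condition on `y`, so finite partial sums suffice.
  have hcl : IsClosed {y : EuclideanSpace 𝕜 (Fin n) | ‖inner 𝕜 y w‖ₑ ≤ R} :=
    isClosed_le (by fun_prop) continuous_const
  refine closure_minimal ?_ hcl hy
  rintro _ ⟨A, a, hAS, ha, rfl⟩
  classical
  simp only [mem_ofPred_eq]
  rw [sum_inner]
  refine (enorm_sum_le _ _).trans ?_
  rw [← Finset.sum_attach]
  let e : A ↪ S := ⟨fun Q => ⟨Q, hAS Q.2⟩, fun P Q h => Subtype.ext (by simpa using h)⟩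
  refine le_trans ?_ (ENNReal.sum_le_tsum (A.attach.map e))
  rw [Finset.sum_map]
  refine Finset.sum_le_sum fun Q _ => ?_
  rcases ha Q Q.2 with ⟨hx, hv⟩ | ⟨hx, hv⟩
  · rw [show (e Q : Set (Fin d → ℝ)) = Q from rfl, indicator_of_mem hx]
    obtain ⟨c, hc, hvc⟩ := hu (e Q) _ hv
    rw [hvc, sum_inner, Finset.mul_sum]
    refine (enorm_sum_le _ _).trans (Finset.sum_le_sum fun i _ => ?_)
    rw [inner_smul_left, enorm_mul, ← ofReal_norm, ← ofReal_norm,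
      ← ofReal_norm, RCLike.norm_conj, norm_inner_symm]
    gcongr
    exact ENNReal.ofReal_le_of_le_toReal (by simpa using hc i)
  · simp [hv]

/-! ### The main theorem by duality -/

theorem mainTheorem4 (𝕜 : Type*) [RCLike 𝕜] (n : ℕ) (hn : 1 ≤ n) :
    ∃ C : ℝ≥0, ∀ (d : ℕ) (_ : 1 ≤ d) (X : DirectionalBFS 𝕜 d n),
      X.IsKotheReflexive →
      MaximalBounded X.nrm → MaximalBounded (kotheDual X.nrm) →
      ∀ (T : LInfCompact 𝕜 d n → LZero 𝕜 d n) (CT : ℝ), 0 < CT →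
        HasConvexBodyDomination T CT →
        ∀ f : LInfCompact 𝕜 d n, X.nrm f < ⊤ →
          X.nrm (T f) < ⊤ ∧
          X.nrm (T f) ≤ C * ENNReal.ofReal CT * maximalOpNorm X.nrm *
            maximalOpNorm (kotheDual X.nrm) * X.nrm f := by
  -- A factor 2 from the spanning coefficients, `n` from the spanning vectors, and 2 from
  -- sparseness.
  refine ⟨4 * n, fun d _ X hX hM hM' T CT hCT hT f hf => ?_⟩
  suffices h : X.nrm (T f) ≤ ((4 * n : ℝ≥0) : ℝ≥0∞) * ENNReal.ofReal CT * maximalOpNorm X.nrm *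
      maximalOpNorm (kotheDual X.nrm) * X.nrm f by
    refine ⟨h.trans_lt ?_, h⟩
    exact ENNReal.mul_lt_top (ENNReal.mul_lt_top (ENNReal.mul_lt_top (ENNReal.mul_lt_top
      ENNReal.coe_lt_top ENNReal.ofReal_lt_top) hM.opNorm_lt_top) hM'.opNorm_lt_top) hf
  obtain ⟨S, hS, hTS⟩ := hT f
  have : Countable S := hS.countable.to_subtype
  obtain ⟨hcube, E, hE, hdisj⟩ := hS
  have hdisj' : Pairwise (Function.onFun Disjoint fun Q : S => E Q) := fun P Q hPQ =>
    hdisj P.2 Q.2 fun h => hPQ (Subtype.ext h)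
  obtain ⟨⟨B, hB⟩, -⟩ := f.2
  choose u huK hu using fun Q : S => exists_spanning_family (𝕜 := 𝕜) (n := n)
    ⟨0, zero_mem_convexBodyAverage (f : LZero 𝕜 d n) Q⟩
    (isBounded_convexBodyAverage hB (hcube Q Q.2)) (by simp)
  conv_lhs => rw [← show kotheDual (kotheDual X.nrm) = X.nrm from hX]
  refine iSup₂_le fun g hg => ?_
  have hgt : kotheDual X.nrm g < ⊤ := hg ▸ ENNReal.one_lt_top
  -- The `u Q i` depend on `f` alone; the dual vectors depend on `g` and are chosen for each `i`
  -- separately.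
  choose v hvK hv using fun (Q : S) (i : Fin n) => exists_average_inner_eq (hcube Q Q.2)
    (integrableOn_of_maximalBounded hM' (kotheDual_le_of_mem_symHull X.nrm) hgt (hcube Q Q.2))
    (u Q i)
  have hmeas : ∀ (Q : S) (i : Fin n), AEMeasurable (fun x => ‖inner 𝕜 (g x) (u Q i)‖ₑ) volume :=
    fun Q i => (g.aestronglyMeasurable.inner aestronglyMeasurable_const).enorm
  have hmeas' : ∀ Q : S, AEMeasurable (fun x => 2 * ∑ i, ‖inner 𝕜 (g x) (u Q i)‖ₑ) volume :=
    fun Q => (Finset.aemeasurable_fun_sum _ fun i _ => hmeas Q i).const_mul _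
  calc ∫⁻ x, ‖inner 𝕜 (T f x) (g x)‖ₑ
      ≤ ∫⁻ x, ENNReal.ofReal CT * ∑' Q : S, (Q : Set (Fin d → ℝ)).indicator
          (fun x => 2 * ∑ i, ‖inner 𝕜 (g x) (u Q i)‖ₑ) x := by
        refine lintegral_mono_ae ?_
        filter_upwards [hTS] with x hx
        obtain ⟨y, hy, hyx⟩ := hx
        have hCT' : ‖(starRingEnd 𝕜) (CT : 𝕜)‖ₑ = ENNReal.ofReal CT := by
          rw [← ofReal_norm, RCLike.norm_conj, RCLike.norm_ofReal, abs_of_pos hCT]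
        simp only at hyx
        rw [← hyx, inner_smul_left, enorm_mul, hCT']
        gcongr
        exact enorm_inner_le_of_mem_convexBodySum hy u hu
    _ = ENNReal.ofReal CT * ∑' Q : S, 2 * ∑ i, volume (Q : Set (Fin d → ℝ)) *
          ‖inner 𝕜 (v Q i) (u Q i)‖ₑ := by
        rw [lintegral_const_mul' _ _ ENNReal.ofReal_ne_top, lintegral_tsum fun Q =>
          (hmeas' Q).indicator (hcube Q Q.2).measurableSet]
        congr 2
        ext Q
        rw [lintegral_indicator (hcube Q Q.2).measurableSet,
          lintegral_const_mul' _ _ (by simp), lintegral_finsetSum' _ fun i _ =>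
            (hmeas Q i).restrict]
        simp only [hv]
    _ = ENNReal.ofReal CT * (2 * ∑ i, ∑' Q : S, volume (Q : Set (Fin d → ℝ)) *
          ‖inner 𝕜 (v Q i) (u Q i)‖ₑ) := by
        -- With `i` outermost, each inner sum has one vector of each kind per cube, as gluing
        -- requires.
        rw [ENNReal.tsum_mul_left, Summable.tsum_finsetSum fun _ _ => ENNReal.summable]
    _ ≤ ENNReal.ofReal CT * (2 * ∑ _i : Fin n, 2 * ((maximalOpNorm X.nrm * X.nrm f) *
          (maximalOpNorm (kotheDual X.nrm) * kotheDual X.nrm g))) := by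
        gcongr with i
        exact tsum_inner_average_le X hM.opNorm_lt_top hM'.opNorm_lt_top hf hgt (fun Q : S => hcube Q Q.2)
          (fun Q : S => (hE Q Q.2).1) (fun Q : S => (hE Q Q.2).2.1) hdisj'
          (fun Q : S => (hE Q Q.2).2.2) (fun Q => huK Q i) fun Q => hvK Q i
    _ = _ := by
        rw [hg, Finset.sum_const, Finset.card_univ, Fintype.card_fin, nsmul_eq_mul]
        push_cast
        ring
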